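/- A \emph{loop} is a set $Q$ with a binary operation that has a two-sided neutral element $1$ and in which, for all $x,z\in Q$, each of the equations $x\cdot y=z$ and $y\cdot x=z$ has a unique solution $y\in Q$. Write $L_x(y)=xy$ and $R_x(y)=yx$. A subloop $N$ of $Q$ is \emph{normal}, written $N\unlhd Q$, if it is invariant under all inner mappings $L_{yx}^{-1}L_yL_x$, $R_{xy}^{-1}R_yR_x$ and $R_x^{-1}L_x$ $(x,y\in Q)$; then the cosets $xN$ form a loop $Q/N$ under $xN\cdot yN=(xy)N$. The \emph{associator subloop} $A(Q)$ is the smallest normal subloop of $Q$ such that $Q/A(Q)$ is a group. Let $P(Q)$ be the set of all elements of $Q$ that can be written as a product, with the factors in some order and with some association (placement of parentheses), containing each element of $Q$ precisely once. \textbf{Corollary.} For every finite loop $Q$, the following conditions are equivalent: \begin{itemize} \item[(B)] there is no normal subloop $N\unlhd Q$ such that $|N|$ is odd and $Q/N\cong\mathbb{Z}_{2^m}$ for some integer $m\ge 1$; \item[(C)] $P(Q)\cap A(Q)\neq\emptyset$. \end{itemize} -/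

import Mathlib

universe u

/-- A loop: a set with a binary operation having a two-sided neutral element `1`, in which all
equations `x * y = z` and `y * x = z` have a unique solution `y`. -/
class Loop (Q : Type u) extends MulOneClass Q where
  existsUnique_mul_eq : ∀ x z : Q, ∃! y : Q, x * y = z
  existsUnique_eq_mul : ∀ x z : Q, ∃! y : Q, y * x = z

namespace Loop

variable {Q : Type u} [Loop Q]

theorem left_bijective (x : Q) : Function.Bijective (fun y : Q => x * y) :=
  Function.bijective_iff_existsUnique _ |>.2 (existsUnique_mul_eq x)

theorem right_bijective (x : Q) : Function.Bijective (fun y : Q => y * x) :=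
  Function.bijective_iff_existsUnique _ |>.2 (existsUnique_eq_mul x)

/-- The left translation `y ↦ x * y`. -/
noncomputable def leftTrans (x : Q) : Equiv.Perm Q := Equiv.ofBijective _ (left_bijective x)

/-- The right translation `y ↦ y * x`. -/
noncomputable def rightTrans (x : Q) : Equiv.Perm Q := Equiv.ofBijective _ (right_bijective x)

@[simp] theorem leftTrans_apply (x y : Q) : leftTrans x y = x * y := rfl

@[simp] theorem rightTrans_apply (x y : Q) : rightTrans x y = y * x := rfl

/-- The left inner mapping `L(x, y)`: first translate by `x`, then by `y`, then undo the
translation by `y * x`. -/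
noncomputable def leftInner (x y : Q) : Equiv.Perm Q :=
  (leftTrans (y * x))⁻¹ * leftTrans y * leftTrans x

/-- The right inner mapping `R(x, y)`. -/
noncomputable def rightInner (x y : Q) : Equiv.Perm Q :=
  (rightTrans (x * y))⁻¹ * rightTrans y * rightTrans x

/-- The middle inner mapping `T(x)`. -/
noncomputable def middleInner (x : Q) : Equiv.Perm Q :=
  (rightTrans x)⁻¹ * leftTrans x

/-- A loop is a group when its multiplication is associative. -/
def IsGroup (Q : Type u) [Loop Q] : Prop := ∀ a b c : Q, a * b * c = a * (b * c)

end Loop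

/-- A subloop: a subset containing `1` and closed under multiplication and both divisions. -/
structure Subloop (Q : Type u) [Loop Q] extends Submonoid Q where
  mem_of_mul_mem_left : ∀ {x y : Q}, x ∈ carrier → x * y ∈ carrier → y ∈ carrier
  mem_of_mul_mem_right : ∀ {x y : Q}, x ∈ carrier → y * x ∈ carrier → y ∈ carrier

namespace Subloop

open Loop

variable {Q : Type u} [Loop Q]

/-- A subloop is normal if it is invariant under all inner mappings. -/
class Normal (N : Subloop Q) : Prop where
  leftInner_image : ∀ x y : Q, leftInner x y '' N.carrier = N.carrier
  rightInner_image : ∀ x y : Q, rightInner x y '' N.carrier = N.carrier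
  middleInner_image : ∀ x : Q, middleInner x '' N.carrier = N.carrier

/-- The left coset `xN`. -/
def coset (N : Subloop Q) (x : Q) : Set Q := (fun n => x * n) '' N.carrier

/-- Two elements are equivalent when they have the same left coset. -/
def cosetSetoid (N : Subloop Q) : Setoid Q := Setoid.ker N.coset

/-- The set `Q/N` of left cosets of `N`. -/
def Quotient (N : Subloop Q) : Type u := _root_.Quotient N.cosetSetoid

/-- The projection `x ↦ xN`. -/
def proj (N : Subloop Q) (x : Q) : N.Quotient := _root_.Quotient.mk N.cosetSetoid x

theorem proj_eq_proj {N : Subloop Q} {x y : Q} : N.proj x = N.proj y ↔ N.coset x = N.coset y :=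
  _root_.Quotient.eq

theorem proj_surjective (N : Subloop Q) : Function.Surjective N.proj := Quot.exists_rep

theorem self_mem_coset (N : Subloop Q) (x : Q) : x ∈ N.coset x :=
  ⟨1, N.one_mem', mul_one x⟩

theorem coset_mul (N : Subloop Q) [h : N.Normal] (x y : Q) :
    N.coset (x * y) = (fun z => x * z) '' N.coset y := by
  have e : (leftTrans (x * y)) * leftInner y x = leftTrans x * leftTrans y := by
    simp [leftInner, mul_assoc]
  have := congrArg (fun s => leftTrans (x * y) '' s) (h.leftInner_image y x)
  simp only [← Set.image_comp, ← Equiv.Perm.coe_mul, e] at this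
  rw [Equiv.Perm.coe_mul, Set.image_comp] at this
  exact this.symm

theorem coset_eq_right (N : Subloop Q) [h : N.Normal] (x : Q) :
    N.coset x = (fun n => n * x) '' N.carrier := by
  have e : (rightTrans x) * middleInner x = leftTrans x := by
    simp [middleInner]
  have := congrArg (fun s => rightTrans x '' s) (h.middleInner_image x)
  simp only [← Set.image_comp, ← Equiv.Perm.coe_mul, e] at this
  exact this

theorem coset_mul' (N : Subloop Q) [h : N.Normal] (x y : Q) :
    N.coset (x * y) = (fun z => z * y) '' N.coset x := by
  have e : (rightTrans (x * y)) * rightInner x y = rightTrans y * rightTrans x := by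
    simp [rightInner, mul_assoc]
  have := congrArg (fun s => rightTrans (x * y) '' s) (h.rightInner_image x y)
  simp only [← Set.image_comp, ← Equiv.Perm.coe_mul, e] at this
  rw [Equiv.Perm.coe_mul, Set.image_comp] at this
  rw [coset_eq_right, coset_eq_right]
  exact this.symm

theorem coset_of_mem (N : Subloop Q) {n : Q} (hn : n ∈ N.carrier) : N.coset n = N.carrier := by
  ext z
  constructor
  · rintro ⟨k, hk, rfl⟩
    exact N.mul_mem' hn hk
  · intro hz
    obtain ⟨k, hk, -⟩ := existsUnique_mul_eq n z
    exact ⟨k, N.mem_of_mul_mem_left hn (by simpa only [hk] using hz), hk⟩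

theorem proj_eq_proj_iff_mem {N : Subloop Q} [N.Normal] {x y : Q} :
    N.proj x = N.proj y ↔ x ∈ N.coset y := by
  rw [proj_eq_proj]
  constructor
  · intro h
    exact h ▸ N.self_mem_coset x
  · rintro ⟨n, hn, rfl⟩
    change N.coset (y * n) = N.coset y
    rw [coset_mul, coset_of_mem N hn]
    rfl

theorem proj_mul_left_iff {N : Subloop Q} [N.Normal] (x : Q) {y y' : Q} :
    N.proj (x * y) = N.proj (x * y') ↔ N.proj y = N.proj y' := by
  rw [proj_eq_proj, proj_eq_proj, coset_mul, coset_mul]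
  exact (left_bijective x).1.image_injective.eq_iff

theorem proj_mul_right_iff {N : Subloop Q} [N.Normal] {x x' : Q} (y : Q) :
    N.proj (x * y) = N.proj (x' * y) ↔ N.proj x = N.proj x' := by
  rw [proj_eq_proj, proj_eq_proj, coset_mul', coset_mul']
  exact (right_bijective y).1.image_injective.eq_iff

/-- Multiplication of cosets, `xN * yN = (x * y)N`. -/
instance (N : Subloop Q) [N.Normal] : Mul N.Quotient where
  mul := _root_.Quotient.map₂ (fun x y => x * y) (by
    intro x x' hx y y' hy
    have hx : N.proj x = N.proj x' := _root_.Quotient.sound hx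
    have hy : N.proj y = N.proj y' := _root_.Quotient.sound hy
    exact _root_.Quotient.exact
      (((proj_mul_right_iff y).2 hx).trans ((proj_mul_left_iff x').2 hy)))

theorem proj_mul (N : Subloop Q) [N.Normal] (x y : Q) : N.proj (x * y) = N.proj x * N.proj y := rfl

/-- The factor loop `Q/N`. -/
instance (N : Subloop Q) [N.Normal] : Loop N.Quotient where
  one := N.proj 1
  one_mul a := by
    obtain ⟨x, rfl⟩ := N.proj_surjective a
    exact (N.proj_mul 1 x).symm.trans (by rw [one_mul])
  mul_one a := by
    obtain ⟨x, rfl⟩ := N.proj_surjective a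
    exact (N.proj_mul x 1).symm.trans (by rw [mul_one])
  existsUnique_mul_eq a c := by
    obtain ⟨x, rfl⟩ := N.proj_surjective a
    obtain ⟨z, rfl⟩ := N.proj_surjective c
    obtain ⟨y, rfl, -⟩ := existsUnique_mul_eq x z
    refine ⟨N.proj y, rfl, fun b hb => ?_⟩
    obtain ⟨y', rfl⟩ := N.proj_surjective b
    exact (proj_mul_left_iff x).1 hb
  existsUnique_eq_mul a c := by
    obtain ⟨x, rfl⟩ := N.proj_surjective a
    obtain ⟨z, rfl⟩ := N.proj_surjective c
    obtain ⟨y, rfl, -⟩ := existsUnique_eq_mul x z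
    refine ⟨N.proj y, rfl, fun b hb => ?_⟩
    obtain ⟨y', rfl⟩ := N.proj_surjective b
    exact (proj_mul_right_iff x).1 hb

end Subloop

namespace Loop

/-- The associator subloop `A(Q)`: the intersection of all normal subloops `N` such that `Q/N` is a
group. It is itself the smallest such normal subloop, see `associatorSubloop_normal`,
`isGroup_quotient_associatorSubloop` and `associatorSubloop_le`. -/
def associatorSubloop (Q : Type u) [Loop Q] : Subloop Q where
  carrier := {x | ∀ (N : Subloop Q) [N.Normal], IsGroup N.Quotient → x ∈ N.carrier}
  one_mem' := fun N _ _ => N.one_mem'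
  mul_mem' := fun hx hy N _ hN => N.mul_mem' (hx N hN) (hy N hN)
  mem_of_mul_mem_left := fun hx hxy N _ hN => N.mem_of_mul_mem_left (hx N hN) (hxy N hN)
  mem_of_mul_mem_right := fun hx hxy N _ hN => N.mem_of_mul_mem_right (hx N hN) (hxy N hN)

variable {Q : Type u} [Loop Q]

theorem image_associatorSubloop (f : Equiv.Perm Q)
    (hf : ∀ (N : Subloop Q) [N.Normal], f '' N.carrier = N.carrier) :
    f '' (associatorSubloop Q).carrier = (associatorSubloop Q).carrier := by
  have key : ∀ (N : Subloop Q) [N.Normal] (x : Q), f x ∈ N.carrier ↔ x ∈ N.carrier := by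
    intro N _ x
    conv_lhs => rw [← hf N]
    exact f.injective.mem_set_image
  ext y
  obtain ⟨x, rfl⟩ := f.surjective y
  rw [f.injective.mem_set_image]
  exact ⟨fun h N _ hN => (key N x).2 (h N hN), fun h N _ hN => (key N x).1 (h N hN)⟩

instance associatorSubloop_normal : (associatorSubloop Q).Normal where
  leftInner_image x y := image_associatorSubloop _ fun _ h => h.leftInner_image x y
  rightInner_image x y := image_associatorSubloop _ fun _ h => h.rightInner_image x y
  middleInner_image x := image_associatorSubloop _ fun _ h => h.middleInner_image x

theorem isGroup_quotient_associatorSubloop : IsGroup (associatorSubloop Q).Quotient := by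
  intro a b c
  obtain ⟨x, rfl⟩ := Subloop.proj_surjective _ a
  obtain ⟨y, rfl⟩ := Subloop.proj_surjective _ b
  obtain ⟨z, rfl⟩ := Subloop.proj_surjective _ c
  simp only [← Subloop.proj_mul]
  rw [Subloop.proj_eq_proj_iff_mem]
  obtain ⟨n, hn, -⟩ := existsUnique_mul_eq (x * (y * z)) (x * y * z)
  refine ⟨n, fun N _ hN => ?_, hn⟩
  have h : N.proj (x * y * z) = N.proj (x * (y * z)) := hN (N.proj x) (N.proj y) (N.proj z)
  obtain ⟨k, hk, hk'⟩ := Subloop.proj_eq_proj_iff_mem.1 h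
  rwa [(left_bijective (x * (y * z))).1 (hn.trans hk'.symm)]

theorem associatorSubloop_le (N : Subloop Q) [N.Normal] (hN : IsGroup N.Quotient) :
    (associatorSubloop Q).carrier ⊆ N.carrier := fun _ hx => hx N hN

/-- The factors, from left to right, of a parenthesized formal product. -/
def factors {α : Type u} : FreeMagma α → List α
  | .of x => [x]
  | .mul s t => factors s ++ factors t

/-- The set `P(Q)` of full products of `Q`: the values in `Q` of the parenthesized products, with
the factors in any order and any association, that contain each element of `Q` precisely once. -/
def fullProducts (Q : Type u) [Loop Q] : Set Q :=
  {q | ∃ t : FreeMagma Q,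
    (factors t).Nodup ∧ (∀ x : Q, x ∈ factors t) ∧ FreeMagma.lift (fun x : Q => x) t = q}

end Loop

/-! Let `G` be the group `Q/A(Q)`. A product over `Q` lands in `A(Q)` iff its image in `G` is `1`,
and there parentheses do not matter: the question is whether the multiset containing each element of
`G` exactly `|A(Q)|` times has an ordering with product `1` (`map_proj_univ`, `map_lift_eq_prod`).

Two copies of `G` cancel against each other, so only odd `|A(Q)|` matters, and there one copy of `G`
must be ordered (`orderable_univ_of_no_cyclic_quotient`). Elements with `g * g ≠ 1` cancel in pairs
`g, g⁻¹`; an involution `t` not commuting with an involution `x` is absorbed by `(x * t * x) * x * t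
= x`. What remains is a core: either a maximal set of at least two commuting involutions, or a
central involution `⁅x, y⁆` of a nonabelian Sylow 2-subgroup together with `x, y, x⁻¹, y⁻¹`. If
neither exists and `|G|` is even, the Sylow 2-subgroups are cyclic and transfer yields the quotient
excluded by (B).

Conversely, if `Q/N` is cyclic of order `2 ^ m` with `m ≥ 1` and `|N|` odd, then `A(Q) ≤ N`, but
every full product maps to an odd multiple of the sum of `ZMod (2 ^ m)`, which is nonzero. -/

open scoped commutatorElement

/-! ### Orderings with product `1` -/

/-- A multiset of elements of a monoid can be ordered so that the product is `1`. -/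
def Multiset.Orderable {G : Type*} [Monoid G] (m : Multiset G) : Prop :=
  ∃ l : List G, (l : Multiset G) = m ∧ l.prod = 1

/-- To extend a property from `m` to `m + T`, one may add the points of `T` in the pairs
`{t, σ t}` of a fixed point free involution `σ` of `T`. -/
theorem Finset.add_val_induction_of_involution {α : Type*} [DecidableEq α]
    (P : Multiset α → Prop) (σ : α → α) (T : Finset α)
    (hT : ∀ t ∈ T, σ t ∈ T) (hσ : ∀ t ∈ T, σ (σ t) = t) (hne : ∀ t ∈ T, σ t ≠ t)
    (step : ∀ m, ∀ t ∈ T, P m → P (t ::ₘ σ t ::ₘ m)) (m : Multiset α) (hm : P m) :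
    P (m + T.val) := by
  induction T using Finset.strongInduction generalizing m with
  | H T ih =>
    obtain rfl | ⟨t, ht⟩ := T.eq_empty_or_nonempty
    · simpa using hm
    have h1 : σ t ∈ T.erase t := Finset.mem_erase.2 ⟨hne t ht, hT t ht⟩
    have h2 : T.val = t ::ₘ σ t ::ₘ ((T.erase t).erase (σ t)).val := by
      rw [Finset.erase_val, Multiset.cons_erase (Finset.mem_def.1 h1), Finset.erase_val,
        Multiset.cons_erase (Finset.mem_def.1 ht)]
    have h3 : m + T.val = (t ::ₘ σ t ::ₘ m) + ((T.erase t).erase (σ t)).val := by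
      rw [h2]; simp
    rw [h3]
    have hsub : (T.erase t).erase (σ t) ⊆ T :=
      (Finset.erase_subset _ _).trans (Finset.erase_subset _ _)
    refine ih _ ⟨hsub, fun h => ?_⟩ ?_ (fun s hs => hσ s (hsub hs)) (fun s hs => hne s (hsub hs))
      (fun m s hs => step m s (hsub hs)) _ (step m t ht hm)
    · simpa using h ht
    · intro s hs
      have hsT := hsub hs
      simp only [Finset.mem_erase] at hs ⊢
      refine ⟨fun h => hs.2.1 ?_, fun h => hs.1 ?_, hT s hsT⟩
      · rw [← hσ s hsT, h, hσ t ht]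
      · rw [← hσ s hsT, h]

namespace Multiset.Orderable

variable {G : Type*} [Group G]

theorem zero : (0 : Multiset G).Orderable := ⟨[], rfl, rfl⟩

theorem add {m n : Multiset G} (hm : m.Orderable) (hn : n.Orderable) : (m + n).Orderable := by
  obtain ⟨l, rfl, hl⟩ := hm
  obtain ⟨k, rfl, hk⟩ := hn
  exact ⟨l ++ k, by simp, by simp [hl, hk]⟩

theorem nsmul {m : Multiset G} (hm : m.Orderable) (k : ℕ) : (k • m).Orderable := by
  induction k with
  | zero => simpa using zero
  | succ k ih => rw [succ_nsmul]; exact ih.add hm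

/-- List the group, then the inverses in reverse order: everything telescopes. -/
theorem two_nsmul_univ [Fintype G] : (2 • (Finset.univ : Finset G).val).Orderable := by
  refine ⟨Finset.univ.toList ++ (Finset.univ.toList.map (·⁻¹)).reverse, ?_, ?_⟩
  · rw [two_nsmul, ← Multiset.coe_add, Multiset.coe_reverse, ← Multiset.map_coe,
      Finset.coe_toList]
    exact congrArg _ (congrArg Finset.val (Finset.map_univ_equiv (Equiv.inv G)))
  · rw [List.prod_append, ← List.prod_inv_reverse, mul_inv_cancel]

theorem add_pairs [DecidableEq G] {m : Multiset G} (hm : m.Orderable) (T : Finset G)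
    (hT : ∀ t ∈ T, t⁻¹ ∈ T) (hne : ∀ t ∈ T, t * t ≠ 1) : (m + T.val).Orderable := by
  refine Finset.add_val_induction_of_involution _ (·⁻¹) T hT (fun t _ => inv_inv t)
    (fun t ht h => hne t ht ?_) ?_ m hm
  · rw [mul_eq_one_iff_eq_inv, h]
  · rintro _ t - ⟨l, rfl, hl⟩
    exact ⟨t :: t⁻¹ :: l, by simp, by simp [hl]⟩

/-- Nest conjugate pairs of involutions around an involution. -/
theorem add_conj [DecidableEq G] {m : Multiset G} (hm : m.Orderable) {x : G} (hx : x ∈ m)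
    (hxx : x * x = 1) (T : Finset G) (hT : ∀ t ∈ T, x * t * x ∈ T) (hTT : ∀ t ∈ T, t * t = 1)
    (hne : ∀ t ∈ T, x * t ≠ t * x) : (m + T.val).Orderable := by
  -- The induction carries `x ∈ m`, since each new pair is inserted around an occurrence of `x`.
  refine (Finset.add_val_induction_of_involution (fun m => x ∈ m ∧ m.Orderable)
    (fun t => x * t * x) T hT (fun t _ => ?_) (fun t ht h => hne t ht ?_) ?_ m ⟨hx, hm⟩).2
  · calc x * (x * t * x) * x = (x * x) * t * (x * x) := by group
      _ = t := by simp [hxx]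
  · calc x * t = x * t * (x * x) := by simp [hxx]
      _ = (x * t * x) * x := by group
      _ = t * x := by rw [h]
  · rintro _ t ht ⟨hxm, l, rfl, hl⟩
    refine ⟨Multiset.mem_cons_of_mem (Multiset.mem_cons_of_mem hxm), ?_⟩
    obtain ⟨l₁, l₂, rfl⟩ := List.append_of_mem (Multiset.mem_coe.1 hxm)
    refine ⟨l₁ ++ x * t * x :: x :: t :: l₂, ?_, ?_⟩
    · simp only [← Multiset.coe_add, ← Multiset.cons_coe, ← Multiset.singleton_add]
      abel
    · rw [← hl]
      simp only [List.prod_append, List.prod_cons]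
      congr 1
      calc x * t * x * (x * (t * l₂.prod)) = x * t * (x * x) * t * l₂.prod := by group
        _ = x * (t * t) * l₂.prod := by rw [hxx]; group
        _ = x * l₂.prod := by rw [hTT t ht, mul_one]

end Multiset.Orderable

/-! ### Reduction to a core of commuting involutions -/

section Involutions

variable {G : Type*} [Group G] [Fintype G] [DecidableEq G]

/-- The involutions that commute with all elements of `Y`. -/
def involutionsCentralizing (Y : Finset G) : Finset G :=
  {t | t ≠ 1 ∧ t * t = 1 ∧ ∀ y ∈ Y, y * t = t * y}

theorem mem_involutionsCentralizing {Y : Finset G} {t : G} :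
    t ∈ involutionsCentralizing Y ↔ t ≠ 1 ∧ t * t = 1 ∧ ∀ y ∈ Y, y * t = t * y := by
  simp [involutionsCentralizing]

/-- Dropping `x` from `insert x Z ⊆ Y` adds the involutions that centralize `Z` but do not commute
with `x`. Conjugation by `x` permutes them without fixed points, because `x` itself centralizes `Z`,
so `add_conj` absorbs them. At `Z = ∅` all involutions are present; `K` holds the non-involutions
already used. -/
theorem orderable_univ_of_involutionsCentralizing (Y K : Finset G)
    (hY : ∀ x ∈ Y, x ∈ involutionsCentralizing Y)
    (hK : ∀ x ∈ K, x⁻¹ ∈ K) (hKK : ∀ x ∈ K, x * x ≠ 1)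
    (h : ((involutionsCentralizing Y).val + K.val).Orderable) :
    (Finset.univ : Finset G).val.Orderable := by
  have key : ∀ Z ⊆ Y, ((involutionsCentralizing Z).val + K.val).Orderable →
      ((involutionsCentralizing (∅ : Finset G)).val + K.val).Orderable := by
    intro Z
    induction Z using Finset.induction_on with
    | empty => exact fun _ h => h
    | insert x Z hxZ ih =>
      intro hZ h
      refine ih ((Finset.subset_insert _ _).trans hZ) ?_
      have hx := mem_involutionsCentralizing.1 (hY x (hZ (Finset.mem_insert_self _ _)))
      have hxc : ∀ y ∈ Z, y * x = x * y := fun y hy => hx.2.2 y (hZ (Finset.mem_insert_of_mem hy))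
      have hsub : involutionsCentralizing (insert x Z) ⊆ involutionsCentralizing Z := by
        intro t ht
        rw [mem_involutionsCentralizing] at ht ⊢
        exact ⟨ht.1, ht.2.1, fun y hy => ht.2.2 y (Finset.mem_insert_of_mem hy)⟩
      have hT : ∀ t ∈ involutionsCentralizing Z \ involutionsCentralizing (insert x Z),
          (t ≠ 1 ∧ t * t = 1 ∧ ∀ y ∈ Z, y * t = t * y) ∧ x * t ≠ t * x := by
        intro t ht
        simp only [Finset.mem_sdiff, mem_involutionsCentralizing, Finset.forall_mem_insert] at ht
        tauto
      have hxi : x⁻¹ = x := (mul_eq_one_iff_eq_inv.1 hx.2.1).symm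
      have := h.add_conj (x := x) (Multiset.mem_add.2 (Or.inl ?_)) hx.2.1
        (involutionsCentralizing Z \ involutionsCentralizing (insert x Z)) ?_
        (fun t ht => (hT t ht).1.2.1) (fun t ht => (hT t ht).2)
      · have e : (involutionsCentralizing Z).val = (involutionsCentralizing (insert x Z)).val +
            (involutionsCentralizing Z \ involutionsCentralizing (insert x Z)).val := by
          rw [Finset.sdiff_val, add_tsub_cancel_of_le (Finset.val_le_iff.2 hsub)]
        rw [e, add_right_comm]
        exact this
      · rw [Finset.mem_val, mem_involutionsCentralizing, Finset.forall_mem_insert]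
        exact ⟨hx.1, hx.2.1, rfl, hxc⟩
      · intro t ht
        obtain ⟨⟨h1, h2, h3⟩, h4⟩ := hT t ht
        have c : x * t * x = x * t * x⁻¹ := by rw [hxi]
        simp only [Finset.mem_sdiff, mem_involutionsCentralizing, Finset.forall_mem_insert]
        refine ⟨⟨?_, ?_, ?_⟩, ?_⟩
        · rw [c, ne_eq, conj_eq_one_iff]; exact h1
        · rw [c, conj_mul, h2]; simp
        · intro y hy
          rw [← mul_assoc, ← mul_assoc, hxc y hy, mul_assoc x y t, h3 y hy, ← mul_assoc,
            mul_assoc _ y x, hxc y hy, ← mul_assoc]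
        · intro h
          apply h4
          have := h.2.2.1
          rw [← mul_assoc, ← mul_assoc, hx.2.1, one_mul, mul_assoc (x * t), hx.2.1, mul_one] at this
          exact this.symm
  have h1 := key Y subset_rfl h
  have h2 : ({1} : Multiset G).Orderable := ⟨[1], rfl, by simp⟩
  have h3 := (h2.add h1).add_pairs (({x | x * x ≠ 1} : Finset G) \ K) (by
    intro t ht
    simp only [Finset.mem_sdiff, Finset.mem_filter, Finset.mem_univ, true_and] at ht ⊢
    refine ⟨fun h => ht.1 ?_, fun h => ht.2 (by simpa using hK _ h)⟩
    rw [← mul_inv_rev, inv_eq_one] at h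
    exact h) (by simp +contextual)
  -- The group is the disjoint union of `{1}`, the involutions, and the elements with nontrivial
  -- square, which include `K`.
  convert h3 using 1
  have hKs : K ⊆ ({x | x * x ≠ 1} : Finset G) := fun x hx => by simpa using hKK x hx
  rw [Finset.sdiff_val, add_assoc, add_assoc, add_tsub_cancel_of_le (Finset.val_le_iff.2 hKs)]
  refine Multiset.Nodup.ext (Finset.nodup _) ?_ |>.2 ?_
  · simp only [Multiset.singleton_add, Multiset.nodup_cons, Multiset.mem_add, Finset.mem_val,
      mem_involutionsCentralizing, Finset.mem_filter]
    refine ⟨by simp, (Multiset.Nodup.add_iff (Finset.nodup _) (Finset.nodup _)).2 ?_⟩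
    rw [Finset.disjoint_val, Finset.disjoint_left]
    intro a ha
    simp [(mem_involutionsCentralizing.1 ha).2.1]
  · intro a
    simp only [Finset.mem_val, Finset.mem_univ, Multiset.mem_add, Multiset.mem_singleton,
      mem_involutionsCentralizing, Finset.mem_filter, true_and, true_iff]
    by_cases ha : a * a = 1 <;> by_cases h1 : a = 1 <;> simp [ha, h1]

/-- The product of a maximal set of at least two commuting involutions. -/
theorem orderable_of_eq_involutionsCentralizing {X : Finset G}
    (hX : involutionsCentralizing X = X) {a b : G} (ha : a ∈ X) (hb : b ∈ X) (hab : a ≠ b) :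
    X.val.Orderable := by
  have hmem : ∀ t, t ∈ X ↔ t ≠ 1 ∧ t * t = 1 ∧ ∀ y ∈ X, y * t = t * y := fun t => by
    conv_lhs => rw [← hX]
    exact mem_involutionsCentralizing
  -- By maximality `X` with `1` adjoined is closed under products. The pairs `{t, x * t}` partition
  -- `X.erase x` and each has product `x`, so the whole product is a power of `x`. Two choices of
  -- `x` then force it to be `1`.
  have key : ∀ x ∈ X, X.toList.prod = 1 ∨ X.toList.prod = x := by
    intro x hx
    obtain ⟨hx1, hxx, hxc⟩ := (hmem x).1 hx
    have h := Finset.add_val_induction_of_involution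
      (fun m : Multiset G => ∃ l : List G, (l : Multiset G) = m ∧ (l.prod = 1 ∨ l.prod = x))
      (fun t => x * t) (X.erase x) (by
        intro t ht
        obtain ⟨htx, ht⟩ := Finset.mem_erase.1 ht
        obtain ⟨ht1, htt, htc⟩ := (hmem t).1 ht
        refine Finset.mem_erase.2 ⟨by simpa using ht1, (hmem _).2 ⟨fun h => htx ?_, ?_, ?_⟩⟩
        · exact mul_left_cancel (h.trans hxx.symm)
        · rw [mul_assoc, ← mul_assoc t x t, ← htc x hx, mul_assoc x t t, htt, mul_one, hxx]
        · intro y hy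
          rw [← mul_assoc, hxc y hy, mul_assoc, htc y hy, mul_assoc])
      (fun t _ => by rw [← mul_assoc, hxx, one_mul])
      (fun t _ h => hx1 (by simpa using h)) (by
        rintro _ t ht ⟨l, rfl, hl⟩
        obtain ⟨htx, ht⟩ := Finset.mem_erase.1 ht
        obtain ⟨ht1, htt, htc⟩ := (hmem t).1 ht
        refine ⟨t :: (x * t) :: l, by simp, ?_⟩
        have e : (t :: (x * t) :: l).prod = x * l.prod := by
          rw [List.prod_cons, List.prod_cons, ← mul_assoc, htc x hx, ← mul_assoc, htt, one_mul]
        rw [e]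
        rcases hl with hl | hl <;> simp [hl, hxx])
      {x} ⟨[x], rfl, by simp⟩
    obtain ⟨l, hl, hp⟩ := h
    rw [Finset.erase_val, Multiset.singleton_add, Multiset.cons_erase (Finset.mem_def.1 hx),
      ← Finset.coe_toList, Multiset.coe_eq_coe] at hl
    have e : X.toList.prod = l.prod := by
      refine hl.symm.prod_eq' ?_
      refine List.pairwise_of_forall_mem_list fun s hs t ht => ?_
      exact ((hmem t).1 (Finset.mem_toList.1 ht)).2.2 s (Finset.mem_toList.1 hs)
    rwa [e]
  refine ⟨X.toList, Finset.coe_toList X, ?_⟩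
  rcases key a ha with h | h
  · exact h
  rcases key b hb with h' | h'
  · exact h'
  · exact absurd (h.symm.trans h') hab

theorem orderable_univ_of_commuting_involutions {a b : G} (ha1 : a ≠ 1) (hb1 : b ≠ 1)
    (haa : a * a = 1) (hbb : b * b = 1) (hab : a ≠ b) (hc : a * b = b * a) :
    (Finset.univ : Finset G).val.Orderable := by
  obtain ⟨X, hle, hX⟩ := Finite.exists_le_maximal
    (p := fun X : Finset G => X ⊆ involutionsCentralizing X) (a := {a, b}) (by
      intro t ht
      simp only [Finset.mem_insert, Finset.mem_singleton] at ht
      simp only [mem_involutionsCentralizing, Finset.mem_insert, Finset.mem_singleton,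
        forall_eq_or_imp, forall_eq]
      rcases ht with rfl | rfl <;> simp_all)
  have hXX : involutionsCentralizing X = X := by
    refine Finset.Subset.antisymm (fun t ht => ?_) hX.prop
    have htp := mem_involutionsCentralizing.1 ht
    have : insert t X ⊆ involutionsCentralizing (insert t X) := by
      intro s hs
      simp only [mem_involutionsCentralizing, Finset.forall_mem_insert]
      rcases Finset.mem_insert.1 hs with rfl | hs
      · exact ⟨htp.1, htp.2.1, rfl, htp.2.2⟩
      · have hsp := mem_involutionsCentralizing.1 (hX.prop hs)
        exact ⟨hsp.1, hsp.2.1, (htp.2.2 s hs).symm, hsp.2.2⟩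
    exact hX.le_of_ge this (Finset.subset_insert _ _) (Finset.mem_insert_self _ _)
  refine orderable_univ_of_involutionsCentralizing X ∅ hX.prop (by simp) (by simp) ?_
  rw [hXX]
  simpa using orderable_of_eq_involutionsCentralizing hXX (hle (by simp)) (hle (by simp)) hab

/-- With `z = ⁅x, y⁆`, the core `z, x, y, x⁻¹, y⁻¹` multiplies to `z * z = 1`; no involution other
than `z` commutes with `z`, so all the others nest around it. -/
theorem orderable_univ_of_commutator {x y : G} (hx : x * x ≠ 1) (hy : y * y ≠ 1)
    (hz1 : ⁅x, y⁆ ≠ 1) (hzz : ⁅x, y⁆ * ⁅x, y⁆ = 1)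
    (hu : ∀ t : G, t ≠ 1 → t * t = 1 → ⁅x, y⁆ * t = t * ⁅x, y⁆ → t = ⁅x, y⁆) :
    (Finset.univ : Finset G).val.Orderable := by
  have hI : involutionsCentralizing {⁅x, y⁆} = {⁅x, y⁆} := by
    ext t
    simp only [mem_involutionsCentralizing, Finset.mem_singleton, forall_eq]
    exact ⟨fun h => hu t h.1 h.2.1 h.2.2, by rintro rfl; exact ⟨hz1, hzz, rfl⟩⟩
  have hne : x * y ≠ y * x := by rwa [ne_eq, ← commutatorElement_eq_one_iff_mul_comm]
  have hnd : [x, y, x⁻¹, y⁻¹].Nodup := by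
    have h1 : x ≠ y := by rintro rfl; exact hne rfl
    have h2 : x ≠ x⁻¹ := fun h => hx (mul_eq_one_iff_eq_inv.2 h)
    have h3 : x ≠ y⁻¹ := by rintro rfl; exact hne (by simp)
    have h4 : y ≠ x⁻¹ := by rintro rfl; exact hne (by simp)
    have h5 : y ≠ y⁻¹ := fun h => hy (mul_eq_one_iff_eq_inv.2 h)
    simp [h1, h2, h3, h4, h5]
  have hinv : ∀ g : G, g * g ≠ 1 → g⁻¹ * g⁻¹ ≠ 1 := by
    intro g hg h
    rw [← mul_inv_rev, inv_eq_one] at h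
    exact hg h
  refine orderable_univ_of_involutionsCentralizing {⁅x, y⁆} [x, y, x⁻¹, y⁻¹].toFinset
    (by rw [hI]; simp) ?_ ?_ ?_
  · intro g hg
    simp only [List.mem_toFinset, List.mem_cons, List.not_mem_nil, or_false] at hg ⊢
    rcases hg with rfl | rfl | rfl | rfl <;> simp
  · intro g hg
    simp only [List.mem_toFinset, List.mem_cons, List.not_mem_nil, or_false] at hg
    rcases hg with rfl | rfl | rfl | rfl
    exacts [hx, hy, hinv _ hx, hinv _ hy]
  · rw [hI, List.toFinset_val, hnd.dedup]
    refine ⟨[⁅x, y⁆, x, y, x⁻¹, y⁻¹], rfl, ?_⟩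
    have e : [x, y, x⁻¹, y⁻¹].prod = ⁅x, y⁆ := by simp [commutatorElement_def, mul_assoc]
    rw [List.prod_cons, e, hzz]

end Involutions

/-! ### Sylow 2-subgroups -/

/-- Take `y` noncentral but central modulo the center. Then `⁅x ^ n, y⁆ = ⁅x, y⁆ ^ n`, so a suitable
power of `x` brings the order of the commutator down to exactly 2. -/
theorem IsPGroup.exists_commutatorElement_mul_self_eq_one {S : Type*} [Group S] [Finite S]
    (hS : IsPGroup 2 S) (hc : ¬ ∀ a b : S, a * b = b * a) :
    ∃ x y : S, ⁅x, y⁆ ≠ 1 ∧ ⁅x, y⁆ * ⁅x, y⁆ = 1 ∧ ⁅x, y⁆ ∈ Subgroup.center S := by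
  have : Fact (Nat.Prime 2) := ⟨Nat.prime_two⟩
  have : Nontrivial (S ⧸ Subgroup.center S) := by
    rw [QuotientGroup.nontrivial_iff]
    intro h
    refine hc fun a b => ?_
    exact (Subgroup.mem_center_iff.1 (h ▸ Subgroup.mem_top b : b ∈ Subgroup.center S) a)
  have := (hS.to_quotient (Subgroup.center S)).center_nontrivial
  obtain ⟨⟨q, hq⟩, hq1⟩ := exists_ne (1 : Subgroup.center (S ⧸ Subgroup.center S))
  obtain ⟨y, rfl⟩ := QuotientGroup.mk_surjective q
  have hyc : y ∉ Subgroup.center S := fun h =>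
    hq1 (Subtype.ext ((QuotientGroup.eq_one_iff y).2 h))
  have hcen : ∀ x : S, ⁅x, y⁆ ∈ Subgroup.center S := by
    intro x
    rw [← QuotientGroup.eq_one_iff, commutatorElement_def]
    simp only [QuotientGroup.mk_mul, QuotientGroup.mk_inv]
    rw [Subgroup.mem_center_iff.1 hq]
    simp
  obtain ⟨x, hx⟩ : ∃ x, ⁅x, y⁆ ≠ 1 := by
    by_contra! h
    exact hyc (Subgroup.mem_center_iff.2 fun g => commutatorElement_eq_one_iff_mul_comm.1 (h g))
  have hpow : ∀ n : ℕ, ⁅x ^ n, y⁆ = ⁅x, y⁆ ^ n := by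
    intro n
    induction n with
    | zero => simp
    | succ n ih =>
      have e : ⁅x ^ (n + 1), y⁆ = x * ⁅x ^ n, y⁆ * x⁻¹ * ⁅x, y⁆ := by
        simp only [commutatorElement_def, pow_succ']
        group
      rw [e, Subgroup.mem_center_iff.1 (hcen (x ^ n)) x, mul_inv_cancel_right, ih, pow_succ]
  obtain ⟨k, hk⟩ := (IsPGroup.iff_orderOf.1 hS) ⁅x, y⁆
  cases k with
  | zero => exact absurd (orderOf_eq_one_iff.1 (by simpa using hk)) hx
  | succ k =>
    refine ⟨x ^ 2 ^ k, y, ?_, ?_, hcen _⟩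
    · rw [hpow]
      refine pow_ne_one_of_lt_orderOf (by positivity) ?_
      rw [hk]
      exact Nat.pow_lt_pow_right (by norm_num) (Nat.lt_succ_self k)
    · rw [hpow, ← pow_add, ← two_mul, ← pow_succ', ← hk, pow_orderOf_eq_one]

/-- Squaring is at most two-to-one, so `a ^ 2 ^ k = 1` has at most `2 ^ k` solutions, and a finite
group with such bounds is cyclic. -/
theorem IsPGroup.isCyclic_of_comm_of_subsingleton_involutions {S : Type*} [CommGroup S] [Finite S]
    (hS : IsPGroup 2 S)
    (hu : ∀ a b : S, a ≠ 1 → b ≠ 1 → a * a = 1 → b * b = 1 → a = b) : IsCyclic S := by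
  have := Fintype.ofFinite S
  classical
  have two : ∀ k : ℕ, Finset.card {a : S | a ^ 2 ^ k = 1} ≤ 2 ^ k := by
    intro k
    induction k with
    | zero => exact Finset.card_le_one.2 fun a ha b hb => by simp_all
    | succ k ih =>
      refine (Finset.card_le_mul_card_image_of_maps_to (f := fun a : S => a ^ 2)
        (t := {a : S | a ^ 2 ^ k = 1}) ?_ 2 ?_).trans ?_
      · intro a ha
        simpa [← pow_mul, ← pow_succ'] using ha
      · intro b _
        by_contra! h
        obtain ⟨r, s, t, hr, hs, ht, hrs, hrt, hst⟩ := Finset.two_lt_card_iff.1 h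
        simp only [Finset.mem_filter, Finset.mem_univ, true_and] at hr hs ht
        refine hst (mul_left_cancel (a := r⁻¹) (hu _ _ ?_ ?_ ?_ ?_))
        · rwa [ne_eq, inv_mul_eq_one]
        · rwa [ne_eq, inv_mul_eq_one]
        · rw [← pow_two, mul_pow, inv_pow, hr.2, hs.2, inv_mul_cancel]
        · rw [← pow_two, mul_pow, inv_pow, hr.2, ht.2, inv_mul_cancel]
      · rw [pow_succ']
        exact Nat.mul_le_mul_left _ ih
  obtain ⟨N, hN⟩ := IsPGroup.iff_card.1 hS
  refine isCyclic_of_card_pow_eq_one_le fun n hn => ?_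
  -- A solution of `a ^ n = 1` is also one for the exponent `gcd n |S|`, a power of 2.
  obtain ⟨k, -, hk⟩ := (Nat.dvd_prime_pow Nat.prime_two).1 (hN ▸ Nat.gcd_dvd_right n (Nat.card S))
  refine le_trans (Finset.card_le_card ?_) ((two k).trans ?_)
  · intro a ha
    simp only [Finset.mem_filter, Finset.mem_univ, true_and] at ha ⊢
    rw [← hk, ← orderOf_dvd_iff_pow_eq_one]
    exact Nat.dvd_gcd (orderOf_dvd_of_pow_eq_one ha) (hN ▸ orderOf_dvd_natCard a)
  · rw [← hk]
    exact Nat.gcd_le_left _ hn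

/-- Burnside's transfer theorem: 2 is the least prime divisor of the order, so a cyclic Sylow
2-subgroup is centralized by its normalizer and has a normal complement, the kernel of the transfer.
-/
theorem exists_surjective_hom_zmod_two_pow_of_isCyclic {G : Type*} [Group G] [Finite G]
    (hG : Even (Nat.card G)) (P : Sylow 2 G) (hP : IsCyclic P) :
    ∃ m : ℕ, 1 ≤ m ∧ ∃ f : G →* Multiplicative (ZMod (2 ^ m)), Function.Surjective f ∧
      ∃ k, Odd k ∧ Nat.card G = k * 2 ^ m := by
  have : Fact (Nat.Prime 2) := ⟨Nat.prime_two⟩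
  have hmin : (Nat.card G).minFac = 2 := (Nat.minFac_eq_two_iff _).2 hG.two_dvd
  have hle := hP.normalizer_le_centralizer hmin
  have hc : (MonoidHom.transferSylow P hle).ker.IsComplement' P := hP.isComplement' hmin
  have hsurj : Function.Surjective (MonoidHom.transferSylow P hle) := by
    rw [← MonoidHom.range_eq_top]
    apply Subgroup.eq_top_of_card_eq
    rw [← Subgroup.index_ker, hc.symm.index_eq_card]
  obtain ⟨m, hm⟩ := IsPGroup.iff_card.1 P.isPGroup'
  refine ⟨m, ?_, (mulEquivOfCyclicCardEq (G := P) (G' := Multiplicative (ZMod (2 ^ m)))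
    (by simp [hm])).toMonoidHom.comp (MonoidHom.transferSylow P hle), ?_, ?_⟩
  · by_contra h
    have := P.dvd_card_of_dvd_card hG.two_dvd
    rw [hm, Nat.lt_one_iff.1 (not_le.1 h)] at this
    norm_num at this
  · rw [MonoidHom.coe_comp]
    exact (MulEquiv.surjective _).comp hsurj
  · rw [← hc.card_mul_card, ← hm]
    refine ⟨_, Nat.not_even_iff_odd.1 fun h => ?_, rfl⟩
    exact MonoidHom.not_dvd_card_ker_transferSylow P hle h.two_dvd

/-- If a finite group has no quotient of order `2 ^ m > 1` that is cyclic and has a kernel of odd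
order, then its elements have an ordering with product `1`. -/
theorem orderable_univ_of_no_cyclic_quotient {G : Type*} [Group G] [Fintype G]
    (h : ¬ ∃ m : ℕ, 1 ≤ m ∧ ∃ f : G →* Multiplicative (ZMod (2 ^ m)), Function.Surjective f ∧
      ∃ k, Odd k ∧ Nat.card G = k * 2 ^ m) :
    (Finset.univ : Finset G).val.Orderable := by
  classical
  have : Fact (Nat.Prime 2) := ⟨Nat.prime_two⟩
  by_cases hG : Even (Nat.card G)
  swap
  · have hI : involutionsCentralizing (∅ : Finset G) = ∅ := by
      refine Finset.eq_empty_of_forall_notMem fun t ht => hG ?_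
      obtain ⟨h1, h2, -⟩ := mem_involutionsCentralizing.1 ht
      rw [even_iff_two_dvd, ← orderOf_eq_prime (p := 2) (x := t) (by rwa [pow_two]) h1]
      exact orderOf_dvd_natCard t
    refine orderable_univ_of_involutionsCentralizing ∅ ∅ (by simp) (by simp) (by simp) ?_
    rw [hI]
    exact Multiset.Orderable.zero
  by_cases hu : ∃ a b : G, a ≠ 1 ∧ b ≠ 1 ∧ a * a = 1 ∧ b * b = 1 ∧ a ≠ b ∧ a * b = b * a
  · obtain ⟨a, b, ha1, hb1, haa, hbb, hab, hc⟩ := hu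
    exact orderable_univ_of_commuting_involutions ha1 hb1 haa hbb hab hc
  have hu : ∀ a b : G, a ≠ 1 → b ≠ 1 → a * a = 1 → b * b = 1 → a * b = b * a → a = b := by
    intro a b ha1 hb1 haa hbb hc
    by_contra hab
    exact hu ⟨a, b, ha1, hb1, haa, hbb, hab, hc⟩
  obtain ⟨P⟩ : Nonempty (Sylow 2 G) := inferInstance
  by_cases hc : ∀ a b : P, a * b = b * a
  · refine absurd (exists_surjective_hom_zmod_two_pow_of_isCyclic hG P ?_) h
    let _ : CommGroup P := { (inferInstance : Group P) with mul_comm := hc }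
    refine IsPGroup.isCyclic_of_comm_of_subsingleton_involutions P.isPGroup' ?_
    intro a b ha hb haa hbb
    refine Subtype.ext (hu a b ?_ ?_ ?_ ?_ ?_)
    · simpa using ha
    · simpa using hb
    · exact congrArg Subtype.val haa
    · exact congrArg Subtype.val hbb
    · exact congrArg Subtype.val (hc a b)
  · obtain ⟨x, y, hz1, hzz, hz⟩ := P.isPGroup'.exists_commutatorElement_mul_self_eq_one hc
    have hcast : ((⁅x, y⁆ : P) : G) = ⁅(x : G), (y : G)⁆ := rfl
    have hsq : ∀ w : P, w * w = 1 → w = 1 ∨ w = ⁅x, y⁆ := by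
      intro w hw
      by_cases hw1 : w = 1
      · exact Or.inl hw1
      refine Or.inr (Subtype.ext (hu w ⁅(x : G), (y : G)⁆ ?_ ?_ ?_ ?_ ?_))
      · simpa using hw1
      · rw [← hcast]; simpa using hz1
      · exact congrArg Subtype.val hw
      · exact congrArg Subtype.val hzz
      · exact congrArg Subtype.val (Subgroup.mem_center_iff.1 hz w)
    refine orderable_univ_of_commutator (x := (x : G)) (y := y) ?_ ?_ ?_ ?_ ?_
    -- If `x * x = 1`, then `x` is `1` or the central involution, so it commutes with `y`.
    · intro hxx
      rcases hsq x (Subtype.ext hxx) with h | h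
      · exact hz1 (by rw [h, commutatorElement_one_left])
      · exact hz1 (commutatorElement_eq_one_iff_mul_comm.2
          (by rw [h]; exact (Subgroup.mem_center_iff.1 hz y).symm))
    · intro hyy
      rcases hsq y (Subtype.ext hyy) with h | h
      · exact hz1 (by rw [h, commutatorElement_one_right])
      · exact hz1 (commutatorElement_eq_one_iff_mul_comm.2
          (by rw [h]; exact Subgroup.mem_center_iff.1 hz x))
    · rw [← hcast]; simpa using hz1
    · exact congrArg Subtype.val hzz
    · intro t ht1 htt htc
      refine hu t _ ht1 ?_ htt (congrArg Subtype.val hzz) htc.symm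
      rw [← hcast]; simpa using hz1

/-! ### From orderings in a group to parenthesized products in a loop -/

theorem List.exists_map_eq_of_coe_eq_map {α β : Type*} (f : α → β) :
    ∀ (l : List β) (s : Multiset α), (l : Multiset β) = s.map f →
      ∃ k : List α, (k : Multiset α) = s ∧ k.map f = l := by
  intro l
  induction l with
  | nil =>
    intro s hs
    exact ⟨[], (Multiset.map_eq_zero.1 hs.symm).symm, rfl⟩
  | cons b l ih =>
    intro s hs
    obtain ⟨a, ha, rfl⟩ := Multiset.mem_map.1
      (hs ▸ Multiset.mem_coe.2 List.mem_cons_self : b ∈ s.map f)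
    obtain ⟨t, rfl⟩ := Multiset.exists_cons_of_mem ha
    rw [Multiset.map_cons, ← Multiset.cons_coe, Multiset.cons_inj_right] at hs
    obtain ⟨k, rfl, hk⟩ := ih t hs
    exact ⟨a :: k, rfl, by rw [List.map_cons, hk]⟩

namespace Loop

/-- An associative loop is a group. -/
noncomputable abbrev IsGroup.toGroup {H : Type*} [Loop H] (h : IsGroup H) : Group H :=
  { (inferInstance : MulOneClass H) with
    mul_assoc := h
    inv := fun x => (existsUnique_eq_mul x 1).choose
    inv_mul_cancel := fun x => (existsUnique_eq_mul x 1).choose_spec.1 }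

/-- A homomorphism to a monoid maps a parenthesized product to the product of the images. -/
theorem map_lift_eq_prod {Q : Type u} [Loop Q] {H : Type*} [Monoid H] (f : Q → H)
    (hf : ∀ x y, f (x * y) = f x * f y) (t : FreeMagma Q) :
    f (FreeMagma.lift (fun x : Q => x) t) = ((factors t).map f).prod := by
  induction t with
  | ih1 x =>
    change f x = ([x].map f).prod
    simp
  | ih2 s t hs ht =>
    change f (FreeMagma.lift (fun x : Q => x) (s * t)) = ((factors s ++ factors t).map f).prod
    rw [map_mul, hf, hs, ht, List.map_append, List.prod_append]

theorem exists_factors_eq {α : Type u} : ∀ l : List α, l ≠ [] → ∃ t, factors t = l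
  | [], h => absurd rfl h
  | [x], _ => ⟨.of x, rfl⟩
  | x :: y :: l, _ => by
    obtain ⟨t, ht⟩ := exists_factors_eq (y :: l) (by simp)
    exact ⟨.mul (.of x) t, by simp [factors, ht]⟩

end Loop

/-! ### Fibres of the projection, and kernels -/

namespace Subloop

open Loop

variable {Q : Type u} [Loop Q]

theorem card_coset (N : Subloop Q) (x : Q) : Nat.card (N.coset x) = Nat.card N.carrier :=
  Nat.card_image_of_injective (left_bijective x).1 _

/-- Each fibre of the projection is a coset, and left translation makes all cosets the size of `N`.
-/
theorem map_proj_univ [Fintype Q] (N : Subloop Q) [N.Normal] [Fintype N.Quotient] :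
    (Finset.univ : Finset Q).val.map N.proj =
      Nat.card N.carrier • (Finset.univ : Finset N.Quotient).val := by
  classical
  ext g
  obtain ⟨y, rfl⟩ := N.proj_surjective g
  rw [Multiset.count_map, Multiset.count_nsmul,
    Multiset.count_eq_one_of_mem (Finset.nodup _) (Finset.mem_univ_val _), mul_one,
    ← N.card_coset y, Nat.card_eq_fintype_card, Fintype.card_subtype]
  refine congrArg Multiset.card (Multiset.filter_congr fun x _ => ?_)
  rw [eq_comm]
  exact proj_eq_proj_iff_mem

theorem card_eq_mul [Finite Q] (N : Subloop Q) [N.Normal] :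
    Nat.card Q = Nat.card N.carrier * Nat.card N.Quotient := by
  have := Fintype.ofFinite Q
  have : Finite N.Quotient := Finite.of_surjective _ N.proj_surjective
  have := Fintype.ofFinite N.Quotient
  have h := congrArg Multiset.card N.map_proj_univ
  rw [Multiset.card_map, Multiset.card_nsmul] at h
  simpa [Nat.card_eq_fintype_card] using h

theorem mem_of_proj_eq_one {N : Subloop Q} [N.Normal] {x : Q} (h : N.proj x = 1) :
    x ∈ N.carrier := by
  have h1 : N.proj x = N.proj 1 := h
  rw [proj_eq_proj_iff_mem, coset_of_mem N N.one_mem'] at h1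
  exact h1

variable {H : Type*} [CommGroup H]

/-- The kernel of a homomorphism from a loop to a commutative group. -/
def ker (f : Q →* H) : Subloop Q where
  carrier := {x | f x = 1}
  one_mem' := f.map_one
  mul_mem' := fun {x y} hx hy => by
    change f (x * y) = 1
    rw [map_mul, show f x = 1 from hx, show f y = 1 from hy, one_mul]
  mem_of_mul_mem_left := fun {x y} hx hxy => by
    have h : f (x * y) = 1 := hxy
    rwa [map_mul, show f x = 1 from hx, one_mul] at h
  mem_of_mul_mem_right := fun {x y} hx hxy => by
    have h : f (y * x) = 1 := hxy
    rwa [map_mul, show f x = 1 from hx, mul_one] at h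

theorem mem_ker {f : Q →* H} {x : Q} : x ∈ (ker f).carrier ↔ f x = 1 := Iff.rfl

theorem image_ker (f : Q →* H) (φ : Equiv.Perm Q) (h : ∀ x, f (φ x) = f x) :
    φ '' (ker f).carrier = (ker f).carrier := by
  ext y
  obtain ⟨x, rfl⟩ := φ.surjective y
  rw [φ.injective.mem_set_image, mem_ker, mem_ker, h]

/-- A homomorphism to a commutative group cannot distinguish `n` from its image under an inner
mapping; commutativity enters for the middle ones. -/
instance ker_normal (f : Q →* H) : (ker f).Normal where
  leftInner_image x y := image_ker f _ fun n => by
    have e : leftTrans (y * x) (leftInner x y n) = y * (x * n) := by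
      simp [leftInner]
    have := congrArg f e
    simpa [mul_assoc] using this
  rightInner_image x y := image_ker f _ fun n => by
    have e : rightTrans (x * y) (rightInner x y n) = n * x * y := by
      simp [rightInner]
    have := congrArg f e
    simpa [mul_assoc] using this
  middleInner_image x := image_ker f _ fun n => by
    have e : rightTrans x (middleInner x n) = x * n := by
      simp [middleInner]
    have := congrArg f e
    simpa [mul_comm] using this

theorem proj_ker_eq_iff (f : Q →* H) {x y : Q} : (ker f).proj x = (ker f).proj y ↔ f x = f y := by
  rw [proj_eq_proj_iff_mem]
  constructor
  · rintro ⟨n, hn, rfl⟩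
    change f (y * n) = f y
    rw [map_mul, mem_ker.1 hn, mul_one]
  · intro h
    obtain ⟨n, hn, -⟩ := existsUnique_mul_eq y x
    refine ⟨n, mem_ker.2 ?_, hn⟩
    rw [← hn, map_mul] at h
    simpa using h

/-- The first isomorphism theorem for a surjective homomorphism to a commutative group. -/
theorem nonempty_quotient_ker_mulEquiv (f : Q →* H) (hf : Function.Surjective f) :
    Nonempty ((ker f).Quotient ≃* H) := by
  let g : (ker f).Quotient → H :=
    _root_.Quotient.lift f fun x y h => (proj_ker_eq_iff f).1 (_root_.Quotient.sound h)
  have hg : ∀ x, g ((ker f).proj x) = f x := fun _ => rfl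
  have hmul : ∀ a b, g (a * b) = g a * g b := by
    intro a b
    obtain ⟨x, rfl⟩ := (ker f).proj_surjective a
    obtain ⟨y, rfl⟩ := (ker f).proj_surjective b
    rw [← proj_mul, hg, hg, hg, map_mul]
  refine ⟨MulEquiv.ofBijective (MulHom.mk g hmul) ⟨?_, ?_⟩⟩
  · intro a b h
    obtain ⟨x, rfl⟩ := (ker f).proj_surjective a
    obtain ⟨y, rfl⟩ := (ker f).proj_surjective b
    exact (proj_ker_eq_iff f).2 h
  · intro h
    obtain ⟨x, rfl⟩ := hf h
    exact ⟨(ker f).proj x, rfl⟩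

end Subloop

/-! ### The obstruction and the equivalence -/

/-- In additive terms this is `k * 2 ^ (m - 1) * (2 ^ m - 1)`, where both `k` and the last factor
are odd, so `2 ^ m` does not divide it. -/
theorem prod_multiplicative_zmod_two_pow_pow_ne_one {m k : ℕ} (hm : 1 ≤ m) (hk : Odd k) :
    (k • (Finset.univ : Finset (Multiplicative (ZMod (2 ^ m)))).val).prod ≠ 1 := by
  obtain ⟨j, rfl⟩ := Nat.exists_eq_add_of_le' hm
  intro h
  rw [Multiset.prod_nsmul, Finset.prod_val,
    ← Equiv.prod_comp (Multiplicative.ofAdd (α := ZMod (2 ^ (j + 1)))) id] at h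
  have h1 : k • ∑ x : ZMod (2 ^ (j + 1)), x = 0 := by
    rwa [← ofAdd_eq_one, ofAdd_nsmul, ofAdd_sum]
  have h2 : ∑ x : ZMod (2 ^ (j + 1)), x = ((∑ i ∈ Finset.range (2 ^ (j + 1)), i : ℕ) : ZMod _) := by
    rw [Nat.cast_sum]
    refine (Finset.sum_nbij' (fun i : ℕ => (i : ZMod (2 ^ (j + 1)))) ZMod.val ?_ ?_ ?_ ?_ ?_).symm
    · simp
    · simp [ZMod.val_lt]
    · intro a ha
      exact ZMod.val_cast_of_lt (Finset.mem_range.1 ha)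
    · simp
    · simp
  rw [h2, nsmul_eq_mul, ← Nat.cast_mul, ZMod.natCast_eq_zero_iff, Finset.sum_range_id,
    pow_succ, mul_right_comm, Nat.mul_div_cancel _ two_pos, mul_left_comm] at h1
  have h3 := Nat.dvd_of_mul_dvd_mul_left (by positivity) h1
  have h4 : Odd (2 ^ j * 2 - 1) := Nat.Even.sub_odd
    (by have := Nat.one_le_two_pow (n := j); omega) (even_two.mul_left _) odd_one
  exact (Nat.not_even_iff_odd.2 (hk.mul h4)) (even_iff_two_dvd.2 h3)

open Loop in
theorem mainTheorem4 (Q : Type u) [Loop Q] [Finite Q] :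
    (¬ ∃ (N : Subloop Q) (_ : N.Normal), Odd (Nat.card N.carrier) ∧
        ∃ m : ℕ, 1 ≤ m ∧ Nonempty (N.Quotient ≃* Multiplicative (ZMod (2 ^ m)))) ↔
      ((Loop.associatorSubloop Q).carrier ∩ Loop.fullProducts Q).Nonempty := by
  have := Fintype.ofFinite Q
  constructor
  · intro h
    have : Finite (associatorSubloop Q).Quotient :=
      Finite.of_surjective _ (associatorSubloop Q).proj_surjective
    have := Fintype.ofFinite (associatorSubloop Q).Quotient
    let _ : Group (associatorSubloop Q).Quotient :=
      isGroup_quotient_associatorSubloop.toGroup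
    have hord : (Nat.card (associatorSubloop Q).carrier •
        (Finset.univ : Finset (associatorSubloop Q).Quotient).val).Orderable := by
      rcases Nat.even_or_odd' (Nat.card (associatorSubloop Q).carrier) with ⟨c, hc | hc⟩
      · rw [hc, mul_comm, mul_nsmul']
        exact Multiset.Orderable.two_nsmul_univ.nsmul c
      · rw [hc, add_nsmul, mul_comm, mul_nsmul', one_nsmul]
        refine (Multiset.Orderable.two_nsmul_univ.nsmul c).add
          (orderable_univ_of_no_cyclic_quotient ?_)
        -- Pulled back to `Q`, the kernel has order `|A(Q)| * k`, a product of odd numbers,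
        -- contradicting (B).
        rintro ⟨m, hm, f, hf, k, hk, hcard⟩
        let g : Q →* Multiplicative (ZMod (2 ^ m)) :=
          { toFun := fun x => f ((associatorSubloop Q).proj x)
            map_one' := f.map_one
            map_mul' := fun x y =>
              f.map_mul ((associatorSubloop Q).proj x) ((associatorSubloop Q).proj y) }
        have hg : Function.Surjective g := hf.comp (associatorSubloop Q).proj_surjective
        obtain ⟨e⟩ := Subloop.nonempty_quotient_ker_mulEquiv g hg
        refine h ⟨Subloop.ker g, inferInstance, ?_, m, hm, ⟨e⟩⟩
        have h1 := (Subloop.ker g).card_eq_mul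
        rw [(associatorSubloop Q).card_eq_mul, hcard, Nat.card_congr e.toEquiv,
          ← mul_assoc, Nat.card_eq_fintype_card (α := Multiplicative _), Fintype.card_multiplicative,
          ZMod.card] at h1
        rw [← Nat.eq_of_mul_eq_mul_right (by positivity) h1, hc]
        exact (odd_two_mul_add_one c).mul hk
    obtain ⟨l, hl, hprod⟩ := hord
    -- The ordering in the quotient lifts to an ordering of `Q`; any parenthesization of it will do.
    obtain ⟨k, hk, rfl⟩ := List.exists_map_eq_of_coe_eq_map (associatorSubloop Q).proj l
      Finset.univ.val (hl.trans (associatorSubloop Q).map_proj_univ.symm)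
    have hmem : ∀ x, x ∈ k := fun x => by
      rw [← Multiset.mem_coe, hk]; exact Finset.mem_univ_val x
    obtain ⟨t, rfl⟩ := exists_factors_eq k (List.ne_nil_of_mem (hmem 1))
    refine ⟨_, Subloop.mem_of_proj_eq_one ?_, t, ?_, hmem, rfl⟩
    · exact (map_lift_eq_prod (associatorSubloop Q).proj (fun _ _ => rfl) t).trans hprod
    · rw [← Multiset.coe_nodup, hk]
      exact Finset.nodup _
  · rintro ⟨_, hA, t, hnd, hmem, rfl⟩ ⟨N, hN, hodd, m, hm, ⟨e⟩⟩
    have : Finite N.Quotient := Finite.of_surjective _ N.proj_surjective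
    have := Fintype.ofFinite N.Quotient
    -- Associativity is transported back along `e`, giving `A(Q) ≤ N`, so the full product is
    -- trivial modulo `N`.
    have hgroup : IsGroup N.Quotient := fun a b c => e.injective (by simp only [map_mul, mul_assoc])
    have hq := associatorSubloop_le N hgroup hA
    have hval := map_lift_eq_prod (fun x => e (N.proj x))
      (fun x y => by rw [Subloop.proj_mul, map_mul]) t
    have h1 : N.proj (FreeMagma.lift (fun x : Q => x) t) = 1 := by
      change _ = N.proj 1
      rw [Subloop.proj_eq_proj_iff_mem, Subloop.coset_of_mem N N.one_mem']
      exact hq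
    have hfac : (factors t : Multiset Q) = Finset.univ.val :=
      (Multiset.Nodup.ext (Multiset.coe_nodup.2 hnd) (Finset.nodup _)).2 fun x => by
        simp [hmem x]
    have h2 : ((factors t).map fun x => e (N.proj x)).prod =
        (Nat.card N.carrier • (Finset.univ : Finset (Multiplicative (ZMod (2 ^ m)))).val).prod := by
      have h3 : (Finset.univ : Finset Q).val.map (fun x => e (N.proj x)) =
        (Finset.univ.val.map N.proj).map e := (Multiset.map_map _ _ _).symm
      rw [← Multiset.prod_coe, ← Multiset.map_coe, hfac, h3, N.map_proj_univ, Multiset.map_nsmul]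
      congr 2
      exact congrArg Finset.val (Finset.map_univ_equiv e.toEquiv)
    refine prod_multiplicative_zmod_two_pow_pow_ne_one hm hodd ?_
    rw [← h2, ← hval, h1, map_one]
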